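/- **Cutting and stacking.** Let $r_k\ge 2$ and $s(k,i)\ge 0$ ($k\ge 0$, $0\le i<r_k$) be integers. A column is a finite ordered list of disjoint intervals (its levels, from bottom to top) of equal length; its height is the number of levels. Let $C_0$ consist of the single level $[0,1)$. Given $C_k$, of height $h_k$, cut each level into $r_k$ subintervals of equal length; for $0\le i<r_k$ the $i$-th subintervals (counted from the left) form the $i$-th subcolumn. Place $s(k,i)$ new intervals (spacers) of the same length above the $i$-th subcolumn, and then stack the resulting subcolumns, each one above the preceding one, to obtain $C_{k+1}$. The spacers are half-open intervals laid out consecutively to the right of the intervals already used. Let $X\subseteq[0,\infty)$ be the union of all levels, with Lebesgue measure $\mu$. The measure-preserving rank-one transformation with parameters $(r_k)$, $(s(k,i))$ is the map $T$ of $X$, determined up to null sets, that for every $k$ translates each level of $C_k$ except the top one onto the level above it. **Definitions.** Let $T$ be an invertible measure-preserving transformation of a $\sigma$-finite measure space $(X,\mu)$. - $T$ is *weakly doubly ergodic* if for all measurable $A,B\subseteq X$ of positive measure there is $n\in\mathbb Z$ with $\mu(T^nA\cap A)>0$ and $\mu(T^nA\cap B)>0$. - $T$ is *ergodic with isometric coefficients*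 if, for every separable metric space $Y$, every invertible isometry $S:Y\to Y$ and every Borel map $\phi:X\to Y$ with $S\circ\phi=\phi\circ T$ $\mu$-almost everywhere, $\phi$ is constant $\mu$-almost everywhere. **Theorem.** There exists a measure-preserving rank-one transformation $T$ on a $\sigma$-finite measure space $(X,\mu)$ with $\mu(X)=\infty$ that is ergodic with isometric coefficients but not weakly doubly ergodic. Namely, the transformation with $r_k=2$, $s(k,0)=0$ and $s(k,1)=2h_k+1$ for all $k\ge 0$ (so that $h_0=1$ and $h_{k+1}=4h_k+1$), realized as an invertible bimeasurable map of $X$ after a modification on a null set, has these properties. -/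

import Mathlib

open MeasureTheory Set

universe u v

noncomputable section

namespace CutStack

/-! Measure-preserving cutting and stacking with `r k` cuts at stage `k` and `s k i` spacers placed
over the `i`-th subcolumn (`i < r k`) of the `k`-th column, starting from the column `{[0,1)}`.
All levels of the `k`-th column are half-open intervals of the same length `width r k`, so a column
is recorded as the list of the left endpoints of its levels, from bottom to top. -/

/-- The length of the levels of the `k`-th column: each cut is into `r k` pieces of equal length. -/
def width (r : ℕ → ℕ) : ℕ → ℝ
  | 0 => 1
  | k + 1 => width r k / r k

/-- The levels of the `k`-th column fill `[0, rightEnd r s k)`; the spacers added at stage `k` are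
laid out consecutively to the right of this point. -/
def rightEnd (r : ℕ → ℕ) (s : ℕ → ℕ → ℕ) : ℕ → ℝ
  | 0 => 1
  | k + 1 => rightEnd r s k + (∑ i ∈ Finset.range (r k), (s k i : ℝ)) * width r (k + 1)

/-- The `k`-th column, as the list of the left endpoints of its levels. The `i`-th block of column
`k + 1` consists of the `i`-th subcolumn of column `k` (the `i`-th subintervals, from the left, of
the levels of column `k`), followed by the `s k i` new intervals placed over it. -/
def column (r : ℕ → ℕ) (s : ℕ → ℕ → ℕ) : ℕ → List ℝ
  | 0 => [0]
  | k + 1 => (List.range (r k)).flatMap fun (i : ℕ) =>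
      (column r s k).map (fun a => a + (i : ℝ) * width r (k + 1)) ++
      (List.range (s k i)).map (fun (j : ℕ) =>
        rightEnd r s k + ((∑ i' ∈ Finset.range i, (s k i' : ℝ)) + (j : ℝ)) * width r (k + 1))

/-- The height of the `k`-th column: its number of levels. -/
def height (r : ℕ → ℕ) (s : ℕ → ℕ → ℕ) (k : ℕ) : ℕ := (column r s k).length

/-- The left endpoint of the `i`-th level of the `k`-th column (meaningful for
`i < height r s k`). -/
def leftEnd (r : ℕ → ℕ) (s : ℕ → ℕ → ℕ) (k i : ℕ) : ℝ := (column r s k).getD i 0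

/-- The `i`-th level of the `k`-th column (meaningful for `i < height r s k`). -/
def level (r : ℕ → ℕ) (s : ℕ → ℕ → ℕ) (k i : ℕ) : Set ℝ :=
  Ico (leftEnd r s k i) (leftEnd r s k i + width r k)

/-- The underlying space: the union of all levels of all columns. -/
def space (r : ℕ → ℕ) (s : ℕ → ℕ → ℕ) : Set ℝ :=
  {x | ∃ k i, i < height r s k ∧ x ∈ level r s k i}

theorem measurableSet_space (r : ℕ → ℕ) (s : ℕ → ℕ → ℕ) : MeasurableSet (space r s) := by
  have h : space r s = ⋃ (k : ℕ) (i : ℕ) (_ : i < height r s k), level r s k i := by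
    ext x
    simp [space]
  rw [h]
  exact MeasurableSet.iUnion fun k => MeasurableSet.iUnion fun i => MeasurableSet.iUnion fun _ =>
    measurableSet_Ico

/-- Lebesgue measure on the space (the subset `space r s` of `ℝ` is measurable). -/
def leb (r : ℕ → ℕ) (s : ℕ → ℕ → ℕ) : Measure (space r s) :=
  Measure.comap (Subtype.val : space r s → ℝ) volume

/-- `T` is the rank-one transformation given by the cuts `r` and the spacers `s`: it agrees almost
everywhere with the limit of the column maps, where the `k`-th column map translates each level of
the `k`-th column, except the top one, onto the level above it. -/
structure IsRankOne (r : ℕ → ℕ) (s : ℕ → ℕ → ℕ) (T : space r s ≃ᵐ space r s) : Prop where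
  two_le : ∀ k, 2 ≤ r k
  column_map : ∀ k i, i + 1 < height r s k → ∀ᵐ (x : space r s) ∂(leb r s), (x : ℝ) ∈ level r s k i →
    (T x : ℝ) = (x : ℝ) + (leftEnd r s k (i + 1) - leftEnd r s k i)

end CutStack

/-- Weak double ergodicity of an invertible transformation. -/
def WeaklyDoublyErgodic {X : Type u} [MeasurableSpace X] (μ : Measure X) (T : X ≃ᵐ X) : Prop :=
  ∀ A B : Set X, MeasurableSet A → MeasurableSet B → 0 < μ A → 0 < μ B →
    ∃ n : ℤ, 0 < μ ((((T.toEquiv : Equiv.Perm X) ^ n) '' A) ∩ A) ∧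
      0 < μ ((((T.toEquiv : Equiv.Perm X) ^ n) '' A) ∩ B)

/-- Ergodicity with isometric coefficients: every Borel map to a separable metric space that is
almost everywhere equivariant for an invertible isometry is almost everywhere constant. -/
def ErgodicIsometricCoefficients {X : Type u} [MeasurableSpace X] (μ : Measure X)
    (T : X ≃ᵐ X) : Prop :=
  ∀ (Y : Type v) [MetricSpace Y] [TopologicalSpace.SeparableSpace Y] [MeasurableSpace Y]
    [BorelSpace Y] (S : Y ≃ᵢ Y) (φ : X → Y), Measurable φ →
    (∀ᵐ x ∂μ, S (φ x) = φ (T x)) → ∃ y : Y, ∀ᵐ x ∂μ, φ x = y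

end

/-! Both properties come from the recursion h' = 4h + 1 for the column heights.

Isometric coefficients: the two halves of a level of column k lie h_k apart in column k + 1. By
Lebesgue density, a set A of positive measure nearly fills some level of every late column, so
T^(h_k) A meets A in positive measure. For A the preimage of an ε-ball about y, this gives d(S^(h_k)
y, y) < 2ε for all large k. Since h_(k+1) = 4h_k + 1, the isometry S itself moves y by less than 10ε
(`dist_lt_of_pos_measure_preimage_ball`). Ergodicity makes the displacement d(Sφ, φ) constant, hence
zero, and then φ is invariant, hence constant.

No weak double ergodicity: take A and B to be the two lowest levels of column 1. The heights at
which A recurs in later columns are the sums of distinct h_i with i ≥ 1. The h_i grow so fast that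
two sums of two such heights are equal or differ by at least 5 (`IsDesc.add_eq_or`). If T^n A met
both A and B, two such sums would differ by 1. -/

namespace CutStack

/-! ### Explicit form of the columns -/

/-- The heights of the columns: `1, 5, 21, 85, …`. -/
def steepHeight : ℕ → ℕ
  | 0 => 1
  | k + 1 => 4 * steepHeight k + 1

/-- Two cuts at every stage. -/
def steepCuts : ℕ → ℕ := fun _ => 2

/-- No spacers over the left subcolumn and `2 h + 1` spacers over the right one. -/
def steepSpacers (k i : ℕ) : ℕ := if i = 1 then 2 * steepHeight k + 1 else 0

/-- The `i`-th level of the `k`-th column is `[m / 2 ^ k, (m + 1) / 2 ^ k)` with `m = levelPos k i`.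
Beyond the height of the column this is the identity, so `levelPos k` is a permutation of `ℕ`. -/
def levelPos : ℕ → ℕ → ℕ
  | 0, i => i
  | k + 1, i =>
    if i < steepHeight k then 2 * levelPos k i
    else if i < 2 * steepHeight k then 2 * levelPos k (i - steepHeight k) + 1 else i

/-- The inverse of `levelPos k`. -/
def levelIdx : ℕ → ℕ → ℕ
  | 0, m => m
  | k + 1, m =>
    if m < 2 * steepHeight k then
      (if m % 2 = 0 then levelIdx k (m / 2) else steepHeight k + levelIdx k (m / 2))
    else m

theorem steepHeight_succ (k : ℕ) : steepHeight (k + 1) = 4 * steepHeight k + 1 := rfl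

theorem steepHeight_pos (k : ℕ) : 0 < steepHeight k := by
  cases k <;> simp [steepHeight]

theorem four_pow_le_steepHeight (k : ℕ) : 4 ^ k ≤ steepHeight k := by
  induction k with
  | zero => simp [steepHeight]
  | succ k ih => rw [steepHeight_succ, pow_succ]; omega

theorem levelPos_lt {k i : ℕ} (hi : i < steepHeight k) : levelPos k i < steepHeight k := by
  induction k generalizing i with
  | zero => simpa [levelPos] using hi
  | succ k ih =>
    rw [steepHeight_succ] at hi ⊢
    simp only [levelPos]
    split_ifs with h1 h2
    · have := ih h1; omega
    · have := @ih (i - steepHeight k) (by omega); omega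
    · exact hi

theorem levelIdx_lt {k m : ℕ} (hm : m < steepHeight k) : levelIdx k m < steepHeight k := by
  induction k generalizing m with
  | zero => simpa [levelIdx] using hm
  | succ k ih =>
    rw [steepHeight_succ] at hm ⊢
    simp only [levelIdx]
    split_ifs with h1 h2
    · have := @ih (m / 2) (by omega); omega
    · have := @ih (m / 2) (by omega); omega
    · exact hm

theorem levelIdx_levelPos (k i : ℕ) : levelIdx k (levelPos k i) = i := by
  induction k generalizing i with
  | zero => rfl
  | succ k ih =>
    simp only [levelPos]
    split_ifs with h1 h2
    · have := levelPos_lt h1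
      rw [levelIdx, if_pos (by omega), if_pos (by omega), Nat.mul_div_cancel_left _ two_pos, ih]
    · have := @levelPos_lt k (i - steepHeight k) (by omega)
      rw [levelIdx, if_pos (by omega), if_neg (by omega),
        show (2 * levelPos k (i - steepHeight k) + 1) / 2 = levelPos k (i - steepHeight k) by omega,
        ih]
      omega
    · rw [levelIdx, if_neg h2]

theorem levelPos_levelIdx (k m : ℕ) : levelPos k (levelIdx k m) = m := by
  induction k generalizing m with
  | zero => rfl
  | succ k ih =>
    simp only [levelIdx]
    split_ifs with h1 h2
    · have := @levelIdx_lt k (m / 2) (by omega)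
      rw [levelPos, if_pos this, ih]; omega
    · have := @levelIdx_lt k (m / 2) (by omega)
      rw [levelPos, if_neg (by omega), if_pos (by omega), Nat.add_sub_cancel_left, ih]; omega
    · rw [levelPos, if_neg (by omega), if_neg h1]

theorem levelPos_zero (k : ℕ) : levelPos k 0 = 0 := by
  induction k with
  | zero => rfl
  | succ k ih => rw [levelPos, if_pos (steepHeight_pos k), ih]

theorem width_steep (k : ℕ) : width steepCuts k = 1 / 2 ^ k := by
  induction k with
  | zero => simp [width]
  | succ k ih => rw [width, ih, pow_succ]; simp [steepCuts]; ring

theorem rightEnd_steep (k : ℕ) :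
    rightEnd steepCuts steepSpacers k = (steepHeight k : ℝ) / 2 ^ k := by
  induction k with
  | zero => simp [rightEnd, steepHeight]
  | succ k ih =>
    rw [rightEnd, ih, width_steep, steepHeight_succ, pow_succ]
    simp [steepCuts, steepSpacers]
    field_simp
    ring

/-- The two subcolumns are the even and the odd halves of the old levels. The spacers start at 2h_k
/ 2^(k+1) and are stacked in the order in which they are laid out, so position and index agree on
them. -/
theorem column_steep (k : ℕ) : column steepCuts steepSpacers k =
    (List.range (steepHeight k)).map fun i => (levelPos k i : ℝ) / 2 ^ k := by
  induction k with
  | zero => simp [column, steepHeight, levelPos]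
  | succ k ih =>
    rw [column, ih, rightEnd_steep, width_steep, steepHeight_succ,
      show 4 * steepHeight k + 1 = steepHeight k + (steepHeight k + (2 * steepHeight k + 1)) by ring,
      List.range_add, List.range_add]
    simp only [steepCuts, List.range_succ, List.range_zero, List.flatMap_append, List.flatMap_cons,
      List.flatMap_nil, List.nil_append, List.append_nil, List.map_append, List.map_map,
      List.append_assoc]
    have e0 : steepSpacers k 0 = 0 := rfl
    have e1 : steepSpacers k 1 = 2 * steepHeight k + 1 := rfl
    simp only [e0, e1, List.range_zero, List.map_nil, List.nil_append]
    congr 1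
    · refine List.map_congr_left fun i hi => ?_
      have hi' := List.mem_range.1 hi
      simp only [Function.comp, levelPos, if_pos hi', pow_succ]
      push_cast
      field_simp
      ring
    congr 1
    · refine List.map_congr_left fun i hi => ?_
      have hi' := List.mem_range.1 hi
      simp only [Function.comp, levelPos]
      rw [if_neg (by omega), if_pos (by omega), Nat.add_sub_cancel_left, pow_succ]
      push_cast
      field_simp
    · rw [← List.map_append, ← List.range_succ]
      refine List.map_congr_left fun i hi => ?_
      simp only [Function.comp, levelPos]
      rw [if_neg (by omega), if_neg (by omega), pow_succ]
      simp [e0]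
      field_simp
      ring

theorem height_steep (k : ℕ) : height steepCuts steepSpacers k = steepHeight k := by
  simp [height, column_steep]

theorem leftEnd_steep {k i : ℕ} (hi : i < steepHeight k) :
    leftEnd steepCuts steepSpacers k i = (levelPos k i : ℝ) / 2 ^ k := by
  simp [leftEnd, column_steep, hi]

theorem mem_level_steep {k i : ℕ} (hi : i < steepHeight k) {x : ℝ} :
    x ∈ level steepCuts steepSpacers k i ↔ 0 ≤ x ∧ ⌊x * 2 ^ k⌋₊ = levelPos k i := by
  have h2 : (0 : ℝ) < 2 ^ k := by positivity
  rw [level, leftEnd_steep hi, width_steep, ← add_div, mem_Ico, div_le_iff₀ h2, lt_div_iff₀ h2]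
  constructor
  · rintro ⟨h, h'⟩
    have : 0 ≤ x * 2 ^ k := le_trans (Nat.cast_nonneg _) h
    exact ⟨nonneg_of_mul_nonneg_left this h2, (Nat.floor_eq_iff this).2 ⟨h, h'⟩⟩
  · rintro ⟨h, h'⟩
    exact (Nat.floor_eq_iff (by positivity)).1 h'

/-- Column k fills [0, h_k / 2^k), which contains [0, 2^k) because h_k ≥ 4^k. Hence the columns
exhaust the half-line. -/
theorem floor_lt_steepHeight {k : ℕ} {x : ℝ} (hx : 0 ≤ x) (hk : x < 2 ^ k) :
    ⌊x * 2 ^ k⌋₊ < steepHeight k := by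
  refine lt_of_lt_of_le ?_ (four_pow_le_steepHeight k)
  rw [Nat.floor_lt (by positivity)]
  push_cast
  rw [show (4 : ℝ) = 2 * 2 by norm_num, mul_pow]
  gcongr

theorem lt_two_pow_floor (x : ℝ) : x < 2 ^ ⌊x⌋₊ := by
  refine (Nat.lt_floor_add_one x).trans_le ?_
  exact_mod_cast Nat.succ_le_of_lt (Nat.lt_two_pow_self (n := ⌊x⌋₊))

theorem space_steep : space steepCuts steepSpacers = Ici 0 := by
  ext x
  simp only [space, mem_ofPred_eq, mem_Ici, height_steep]
  constructor
  · rintro ⟨k, i, hi, h⟩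
    exact ((mem_level_steep hi).1 h).1
  · intro hx
    have h := floor_lt_steepHeight hx (lt_two_pow_floor x)
    exact ⟨_, _, levelIdx_lt h, (mem_level_steep (levelIdx_lt h)).2 ⟨hx, (levelPos_levelIdx _ _).symm⟩⟩

theorem floor_mul_two_pow_succ (x : ℝ) (k : ℕ) : ⌊x * 2 ^ (k + 1)⌋₊ / 2 = ⌊x * 2 ^ k⌋₊ := by
  rw [← Nat.floor_div_ofNat, pow_succ, ← mul_assoc, mul_div_cancel_right₀ _ two_ne_zero]

/-! ### The limit map on the half-line -/

/-- The translation of each level of the `k`-th column onto the next one. -/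
noncomputable def stageMap (k : ℕ) (x : ℝ) : ℝ :=
  x + ((levelPos k (levelIdx k ⌊x * 2 ^ k⌋₊ + 1) : ℝ) - ⌊x * 2 ^ k⌋₊) / 2 ^ k

/-- The limit of the maps `stageMap k`. -/
noncomputable def step (x : ℝ) : ℝ := stageMap (⌊x⌋₊ + 1) x

/-- The point lies in the `k`-th column, below the top level. -/
def BelowTop (k : ℕ) (x : ℝ) : Prop := levelIdx k ⌊x * 2 ^ k⌋₊ + 1 < steepHeight k

theorem BelowTop.floor_lt {k : ℕ} {x : ℝ} (h : BelowTop k x) : ⌊x * 2 ^ k⌋₊ < steepHeight k := by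
  rw [← levelPos_levelIdx k ⌊x * 2 ^ k⌋₊]
  exact levelPos_lt (by unfold BelowTop at h; omega)

/-- Column k + 1 has spacers above both copies of column k, so no point of column k lies in its top
level. -/
theorem belowTop_succ_of_floor_lt {k : ℕ} {x : ℝ} (h : ⌊x * 2 ^ k⌋₊ < steepHeight k) :
    BelowTop (k + 1) x := by
  have h1 := floor_mul_two_pow_succ x k
  have h2 := levelIdx_lt h
  rw [BelowTop, levelIdx, if_pos (by omega), h1, steepHeight_succ]
  split_ifs <;> omega

/-- Each half of a level sits in its own copy of column k, where the next level is the same half of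
the next level of column k; the translation is unchanged. -/
theorem stageMap_succ {k : ℕ} {x : ℝ} (h : BelowTop k x) : stageMap (k + 1) x = stageMap k x := by
  have h1 := floor_mul_two_pow_succ x k
  have h2 := h.floor_lt
  unfold BelowTop at h
  set m := ⌊x * 2 ^ k⌋₊ with hm
  set m' := ⌊x * 2 ^ (k + 1)⌋₊ with hm'
  rw [stageMap, stageMap, ← hm, ← hm', levelIdx, if_pos (by omega), h1]
  split_ifs with h3
  · rw [levelPos, if_pos h, show m' = 2 * m by omega, pow_succ]
    push_cast
    field_simp
  · rw [levelPos, if_neg (by omega), if_pos (by omega), add_assoc, Nat.add_sub_cancel_left,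
      show m' = 2 * m + 1 by omega, pow_succ]
    push_cast
    field_simp
    ring

theorem BelowTop.mono {k l : ℕ} {x : ℝ} (h : BelowTop k x) (hl : k ≤ l) :
    BelowTop l x ∧ stageMap l x = stageMap k x := by
  induction l, hl using Nat.le_induction with
  | base => exact ⟨h, rfl⟩
  | succ l _ ih => exact ⟨belowTop_succ_of_floor_lt ih.1.floor_lt, (stageMap_succ ih.1).trans ih.2⟩

/-- Since x < 2^⌊x⌋, the point is already in column ⌊x⌋, hence below the top of the following one;
this is why `step` uses stage ⌊x⌋ + 1. -/
theorem belowTop_floor_add_one {x : ℝ} (hx : 0 ≤ x) : BelowTop (⌊x⌋₊ + 1) x :=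
  belowTop_succ_of_floor_lt (floor_lt_steepHeight hx (lt_two_pow_floor x))

theorem step_eq {k : ℕ} {x : ℝ} (hx : 0 ≤ x) (h : BelowTop k x) : step x = stageMap k x := by
  rw [step, ← ((belowTop_floor_add_one hx).mono (le_max_left _ k)).2,
    (h.mono (le_max_right (⌊x⌋₊ + 1) k)).2]

theorem add_div_two_pow {k : ℕ} {x : ℝ} (hx : 0 ≤ x) (n : ℕ) :
    0 ≤ x + ((n : ℝ) - ⌊x * 2 ^ k⌋₊) / 2 ^ k ∧
      ⌊(x + ((n : ℝ) - ⌊x * 2 ^ k⌋₊) / 2 ^ k) * 2 ^ k⌋₊ = n := by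
  have h2 : (0 : ℝ) < 2 ^ k := by positivity
  have e : (x + ((n : ℝ) - ⌊x * 2 ^ k⌋₊) / 2 ^ k) * 2 ^ k = x * 2 ^ k - ⌊x * 2 ^ k⌋₊ + n := by
    field_simp
    ring
  have h0 : 0 ≤ x * 2 ^ k - ⌊x * 2 ^ k⌋₊ := sub_nonneg.2 (Nat.floor_le (by positivity))
  have h1 : x * 2 ^ k - ⌊x * 2 ^ k⌋₊ < 1 := by linarith [Nat.lt_floor_add_one (x * 2 ^ k)]
  have hn : (0 : ℝ) ≤ n := Nat.cast_nonneg n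
  refine ⟨nonneg_of_mul_nonneg_left (e ▸ by linarith) h2, ?_⟩
  rw [e, Nat.floor_eq_iff (by linarith)]
  constructor <;> linarith

theorem floor_stageMap (k : ℕ) {x : ℝ} (hx : 0 ≤ x) : 0 ≤ stageMap k x ∧
    ⌊stageMap k x * 2 ^ k⌋₊ = levelPos k (levelIdx k ⌊x * 2 ^ k⌋₊ + 1) :=
  add_div_two_pow hx _

theorem step_nonneg {x : ℝ} (hx : 0 ≤ x) : 0 ≤ step x := (floor_stageMap _ hx).1

theorem step_injOn : InjOn step (Ici 0) := by
  intro x hx y hy h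
  obtain ⟨h1, -⟩ := (belowTop_floor_add_one hx).mono (le_max_left _ (⌊y⌋₊ + 1))
  obtain ⟨h2, -⟩ := (belowTop_floor_add_one hy).mono (le_max_right (⌊x⌋₊ + 1) _)
  rw [step_eq hx h1, step_eq hy h2] at h
  set k := max (⌊x⌋₊ + 1) (⌊y⌋₊ + 1)
  have e := (floor_stageMap k hx).2
  rw [h, (floor_stageMap k hy).2] at e
  have e1 := congrArg (levelIdx k) e
  rw [levelIdx_levelPos, levelIdx_levelPos, Nat.add_right_cancel_iff] at e1
  have e2 := congrArg (levelPos k) e1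
  rw [levelPos_levelIdx, levelPos_levelIdx] at e2
  rw [stageMap, stageMap, e2] at h
  linarith

/-- The point 0 lies in the bottom level of every column, while an image lies in a level of positive
index. -/
theorem step_pos {x : ℝ} (hx : 0 ≤ x) : 0 < step x := by
  refine (step_nonneg hx).lt_of_ne fun h => ?_
  have e := (floor_stageMap (⌊x⌋₊ + 1) hx).2
  rw [show stageMap (⌊x⌋₊ + 1) x = 0 from h.symm] at e
  have e1 := congrArg (levelIdx (⌊x⌋₊ + 1)) e
  rw [levelIdx_levelPos, zero_mul, Nat.floor_zero] at e1
  conv_lhs at e1 => rw [← levelPos_zero (⌊x⌋₊ + 1), levelIdx_levelPos]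
  omega

theorem exists_step_eq {y : ℝ} (hy : 0 < y) : ∃ x, 0 ≤ x ∧ step x = y := by
  -- The first bound puts y in column k, the second above its bottom level [0, 2^(-k)), so there is
  -- a level below to come from.
  obtain ⟨k, hk1, hk2⟩ : ∃ k : ℕ, y < 2 ^ k ∧ 1 ≤ y * 2 ^ k := by
    refine ⟨max ⌊y⌋₊ ⌊y⁻¹⌋₊, (lt_two_pow_floor y).trans_le ?_, ?_⟩
    · exact pow_le_pow_right₀ one_le_two (le_max_left _ _)
    · rw [← div_le_iff₀' hy, one_div]
      exact (lt_two_pow_floor y⁻¹).le.trans (pow_le_pow_right₀ one_le_two (le_max_right _ _))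
  have hm := floor_lt_steepHeight hy.le hk1
  have hm1 : 1 ≤ ⌊y * 2 ^ k⌋₊ := Nat.le_floor (by simpa using hk2)
  have hi := levelIdx_lt hm
  have hp := levelPos_levelIdx k ⌊y * 2 ^ k⌋₊
  have hi0 : levelIdx k ⌊y * 2 ^ k⌋₊ ≠ 0 := by
    intro h
    rw [h, levelPos_zero] at hp
    omega
  obtain ⟨i, hi'⟩ := Nat.exists_eq_succ_of_ne_zero hi0
  obtain ⟨h0, h1⟩ := add_div_two_pow (k := k) hy.le (levelPos k i)
  refine ⟨_, h0, ?_⟩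
  rw [step_eq (k := k) h0, stageMap, h1, levelIdx_levelPos, ← Nat.succ_eq_add_one, ← hi', hp]
  · ring
  · rw [BelowTop, h1, levelIdx_levelPos]
    omega

theorem measurable_step : Measurable step := by
  have h : ∀ k, Measurable (stageMap k) := fun k =>
    measurable_id.add ((measurable_from_top (f := fun m : ℕ =>
      ((levelPos k (levelIdx k m + 1) : ℝ) - m) / 2 ^ k)).comp
      (Nat.measurable_floor.comp (measurable_id.mul_const _)))
  exact (measurable_from_prod_countable_right (f := fun p : ℕ × ℝ => stageMap (p.1 + 1) p.2)
    fun k => h (k + 1)).comp (Nat.measurable_floor.prodMk measurable_id)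

theorem exists_rat_step (x : ℝ) : ∃ q : ℚ, step x = x + q := by
  refine ⟨((levelPos (⌊x⌋₊ + 1) (levelIdx (⌊x⌋₊ + 1) ⌊x * 2 ^ (⌊x⌋₊ + 1)⌋₊ + 1) : ℚ) -
    ⌊x * 2 ^ (⌊x⌋₊ + 1)⌋₊) / 2 ^ (⌊x⌋₊ + 1), ?_⟩
  rw [step, stageMap]
  push_cast
  rfl


/-! ### Invertibility and invariance of the measure -/

/-- An injective measurable self-map of a standard Borel space that misses exactly one point
becomes invertible after a modification on a countable set. -/
theorem exists_measurableEquiv_of_range_eq_compl {X : Type*} [MeasurableSpace X]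
    [StandardBorelSpace X] {f : X → X} (hf : Measurable f) (hinj : Function.Injective f) {z : X}
    (hz : range f = {z}ᶜ) :
    ∃ (e : X ≃ᵐ X) (O : Set X), O.Countable ∧ (∀ x ∈ O, e x = x) ∧ ∀ x ∉ O, e x = f x := by
  classical
  -- The forward orbit of the missed point: off it, f is a bijection of the complement of O, so f
  -- may be replaced by the identity on O.
  set O : Set X := range fun n : ℕ => f^[n] z
  have hO : O.Countable := countable_range _
  have hmem : ∀ x, f x ∈ O ↔ x ∈ O := by
    intro x
    constructor
    · rintro ⟨n, hn⟩
      cases n with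
      | zero => exact absurd (hz ▸ mem_range_self x : f x ∈ ({z}ᶜ : Set X)) (by simpa using hn.symm)
      | succ n => exact ⟨n, hinj (by simpa [Function.iterate_succ_apply'] using hn)⟩
    · rintro ⟨n, rfl⟩
      exact ⟨n + 1, Function.iterate_succ_apply' f n z⟩
  set g : X → X := fun x => if x ∈ O then x else f x
  have hg1 : ∀ x ∈ O, g x = x := fun x hx => if_pos hx
  have hg2 : ∀ x ∉ O, g x = f x := fun x hx => if_neg hx
  have hgm : Measurable g := Measurable.ite hO.measurableSet measurable_id hf
  have hgi : Function.Injective g := by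
    intro x y h
    by_cases hx : x ∈ O <;> by_cases hy : y ∈ O
    · rwa [hg1 x hx, hg1 y hy] at h
    · rw [hg1 x hx, hg2 y hy] at h
      exact absurd ((hmem y).1 (h ▸ hx)) hy
    · rw [hg2 x hx, hg1 y hy] at h
      exact absurd ((hmem x).1 (h ▸ hy)) hx
    · rw [hg2 x hx, hg2 y hy] at h
      exact hinj h
  have hgs : Function.Surjective g := by
    intro y
    by_cases hy : y ∈ O
    · exact ⟨y, hg1 y hy⟩
    · have : y ∈ range f := by
        rw [hz]
        rintro rfl
        exact hy ⟨0, rfl⟩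
      obtain ⟨x, rfl⟩ := this
      exact ⟨x, hg2 x fun h => hy ((hmem x).2 h)⟩
  refine ⟨{ toEquiv := Equiv.ofBijective g ⟨hgi, hgs⟩
            measurable_toFun := hgm
            measurable_invFun := ?_ }, O, hO, hg1, hg2⟩
  intro s hs
  have := (hgm.measurableEmbedding hgi).measurableSet_image.2 hs
  rwa [← Equiv.image_eq_preimage_symm]

variable {r : ℕ → ℕ} {s : ℕ → ℕ → ℕ}

theorem leb_apply (A : Set (space r s)) : leb r s A = volume (Subtype.val '' A) :=
  (MeasurableEmbedding.subtype_coe (measurableSet_space r s)).comap_apply _ _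

theorem leb_countable {A : Set (space r s)} (hA : A.Countable) : leb r s A = 0 := by
  rw [leb_apply]
  exact (hA.image _).measure_zero _

instance : SigmaFinite (leb r s) := by
  refine SigmaFinite.of_map _ measurable_subtype_coe.aemeasurable ?_
  rw [leb, (MeasurableEmbedding.subtype_coe (measurableSet_space r s)).map_comap]
  infer_instance

/-- A bimeasurable bijection all of whose displacements are rational preserves Lebesgue measure. -/
theorem measurePreserving_of_rat_displacement (T : space r s ≃ᵐ space r s)
    (hT : ∀ x, ∃ q : ℚ, (T x : ℝ) = x + q) : MeasurePreserving T (leb r s) (leb r s) := by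
  have emb := MeasurableEmbedding.subtype_coe (measurableSet_space r s)
  have key : ∀ A : Set (space r s), MeasurableSet A → leb r s (T '' A) = leb r s A := by
    intro A hA
    set P : ℚ → Set (space r s) := fun q => A ∩ {x | (T x : ℝ) = x + q}
    have hP : ∀ q, MeasurableSet (P q) := fun q =>
      hA.inter (measurableSet_eq_fun (measurable_subtype_coe.comp T.measurable)
        (measurable_subtype_coe.add_const _))
    have hd : Pairwise (Function.onFun Disjoint P) := by
      intro q q' hqq
      refine disjoint_left.2 fun x hx hx' => hqq ?_
      have h1 : (T x : ℝ) = x + q := hx.2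
      have h2 : (T x : ℝ) = x + q' := hx'.2
      exact_mod_cast add_left_cancel (h1.symm.trans h2)
    have hU : A = ⋃ q, P q := by
      ext x
      simp only [mem_iUnion]
      constructor
      · intro hx
        obtain ⟨q, hq⟩ := hT x
        exact ⟨q, hx, hq⟩
      · rintro ⟨q, hq⟩
        exact hq.1
    rw [hU, image_iUnion, measure_iUnion hd hP, measure_iUnion]
    · refine tsum_congr fun q => ?_
      rw [leb_apply, leb_apply, image_image]
      have : (fun x => ((T x : space r s) : ℝ)) '' P q =
          (fun x : ℝ => x + q) '' (Subtype.val '' P q) := by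
        rw [image_image]
        exact image_congr fun x hx => hx.2
      rw [this, image_add_right, measure_preimage_add_right]
    · exact fun q q' h => (disjoint_image_iff T.injective).2 (hd h)
    · exact fun q => T.measurableEmbedding.measurableSet_image.2 (hP q)
  refine ⟨T.measurable, Measure.ext fun B hB => ?_⟩
  rw [Measure.map_apply T.measurable hB, ← key _ (T.measurable hB),
    image_preimage_eq _ T.surjective]

/-! ### Iterates moving levels up a column -/

section RankOne

variable {T : space r s ≃ᵐ space r s}

theorem mem_level_translate {k i j : ℕ} {x : ℝ} (hx : x ∈ level r s k i) :
    x + (leftEnd r s k j - leftEnd r s k i) ∈ level r s k j := by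
  have h1 := hx.1
  have h2 := hx.2
  constructor <;> linarith

theorem IsRankOne.iterate (h : IsRankOne r s T) (hT : MeasurePreserving T (leb r s) (leb r s))
    {k i : ℕ} (n : ℕ) (hi : i + n < height r s k) :
    ∀ᵐ (x : space r s) ∂leb r s, (x : ℝ) ∈ level r s k i →
      ((T^[n] x : space r s) : ℝ) ∈ level r s k (i + n) := by
  induction n with
  | zero => simp
  | succ n ih =>
    filter_upwards [ih (by omega), (hT.iterate n).quasiMeasurePreserving.ae
      (h.column_map k (i + n) (by omega))] with x h1 h2 hx
    rw [Function.iterate_succ_apply', h2 (h1 hx)]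
    exact mem_level_translate (h1 hx)

/-- The trace of a level on the space. -/
def lev (r : ℕ → ℕ) (s : ℕ → ℕ → ℕ) (k i : ℕ) : Set (space r s) := Subtype.val ⁻¹' level r s k i

theorem measurableSet_lev (k i : ℕ) : MeasurableSet (lev r s k i) :=
  measurable_subtype_coe measurableSet_Ico

theorem leb_lev {k i : ℕ} (hi : i < height r s k) :
    leb r s (lev r s k i) = ENNReal.ofReal (width r k) := by
  have hsub : level r s k i ⊆ space r s := fun x hx => ⟨k, i, hi, hx⟩
  rw [leb_apply, lev, Subtype.image_preimage_coe, inter_eq_right.2 hsub,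
    level, Real.volume_Ico, add_sub_cancel_left]

/-- If `A` fills more of a level than `B` leaves free of a level above it, then many points of `A`
are carried to `B`. -/
theorem IsRankOne.frequently (h : IsRankOne r s T)
    (hT : MeasurePreserving T (leb r s) (leb r s)) {k i n : ℕ} (hi : i + n < height r s k)
    {A B : Set (space r s)} (hB : MeasurableSet B)
    (hAB : leb r s (lev r s k (i + n) \ B) < leb r s (lev r s k i ∩ A)) :
    ∃ᵐ x ∂leb r s, x ∈ A ∧ T^[n] x ∈ B := by
  intro hne
  refine hAB.not_ge ?_
  rw [← (hT.iterate n).measure_preimage ((measurableSet_lev k _).diff hB).nullMeasurableSet]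
  refine measure_mono_ae ?_
  filter_upwards [hne, h.iterate hT n hi] with x h1 h2 hx
  exact ⟨h2 hx.1, fun h3 => h1 ⟨hx.2, h3⟩⟩

end RankOne

/-! ### Existence of the transformation -/

/-- The space of the steep transformation. -/
abbrev SteepSpace := space steepCuts steepSpacers

/-- Lebesgue measure on the space of the steep transformation. -/
noncomputable abbrev steepLeb : Measure SteepSpace := leb steepCuts steepSpacers

theorem nonneg_steep (x : SteepSpace) : 0 ≤ (x : ℝ) := by
  have h : (x : ℝ) ∈ space steepCuts steepSpacers := x.2
  rwa [space_steep] at h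

theorem leb_univ_steep : steepLeb univ = ⊤ := by
  rw [leb_apply, image_univ, Subtype.range_coe, space_steep, Real.volume_Ici]

theorem exists_isRankOne_steep : ∃ T : SteepSpace ≃ᵐ SteepSpace,
    IsRankOne steepCuts steepSpacers T ∧ MeasurePreserving T steepLeb steepLeb := by
  have : StandardBorelSpace SteepSpace := (measurableSet_space _ _).standardBorel
  have hmem : ∀ {x : ℝ}, 0 ≤ x → x ∈ space steepCuts steepSpacers := by
    intro x hx
    rwa [space_steep]
  set f : SteepSpace → SteepSpace := fun x => ⟨step x, hmem (step_nonneg (nonneg_steep x))⟩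
  obtain ⟨T, O, hO, hT1, hT2⟩ := exists_measurableEquiv_of_range_eq_compl (f := f)
    (measurable_step.comp measurable_subtype_coe).subtype_mk
    (fun x y h => Subtype.ext (step_injOn (nonneg_steep x) (nonneg_steep y) (congrArg Subtype.val h)))
    (z := ⟨0, hmem le_rfl⟩) (by
      ext y
      rw [mem_compl_singleton_iff, mem_range]
      constructor
      · rintro ⟨x, rfl⟩ h
        exact (step_pos (nonneg_steep x)).ne' (congrArg Subtype.val h)
      · intro hy
        obtain ⟨x, hx, h⟩ := exists_step_eq
          ((nonneg_steep y).lt_of_ne fun h => hy (Subtype.ext h.symm))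
        exact ⟨⟨x, hmem hx⟩, Subtype.ext h⟩)
  refine ⟨T, ⟨fun _ => le_rfl, fun k i hi => ?_⟩, measurePreserving_of_rat_displacement T fun x => ?_⟩
  · rw [height_steep] at hi
    have hO' : ∀ᵐ x ∂steepLeb, x ∉ O := measure_eq_zero_iff_ae_notMem.1 (leb_countable hO)
    filter_upwards [hO'] with x hx hl
    obtain ⟨h0, hfl⟩ := (mem_level_steep (by omega)).1 hl
    rw [hT2 x hx]
    change step x = _
    have hidx : levelIdx k ⌊(x : ℝ) * 2 ^ k⌋₊ = i := by rw [hfl, levelIdx_levelPos]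
    rw [step_eq (k := k) h0 (by rw [BelowTop, hidx]; exact hi), stageMap, hidx, hfl,
      leftEnd_steep hi, leftEnd_steep (by omega), sub_div]
  · by_cases hx : x ∈ O
    · exact ⟨0, by simp [hT1 x hx]⟩
    · rw [hT2 x hx]
      exact exists_rat_step x

/-! ### Lebesgue density and ergodicity -/

open Filter Topology

/-- A set of positive measure has a point such that the dyadic intervals of length `2⁻ᵏ` around it
are eventually filled by the set up to a quarter of their length. -/
theorem exists_eventually_dyadic_diff_lt {S : Set ℝ} (hSm : MeasurableSet S)
    (hS : 0 < volume S) :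
    ∃ x ∈ S, 0 ≤ x → ∃ k₀, ∀ k ≥ k₀,
      volume (Ico ((⌊x * 2 ^ k⌋₊ : ℝ) / 2 ^ k) ((⌊x * 2 ^ k⌋₊ : ℝ) / 2 ^ k + 1 / 2 ^ k) \ S) <
        ENNReal.ofReal (1 / 4 * (1 / 2 ^ k)) := by
  have hne : ∃ᵐ x ∂volume, x ∈ S := by
    rw [frequently_ae_iff]
    exact hS.ne'
  obtain ⟨x, hxS, hx⟩ := (hne.and_eventually (ae_imp_of_ae_restrict
    (IsUnifLocDoublingMeasure.ae_tendsto_measure_inter_div volume S 1))).exists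
  refine ⟨x, hxS, fun h0 => ?_⟩
  have hδ : Tendsto (fun k : ℕ => (1 / 2 : ℝ) * (1 / 2) ^ k) atTop (𝓝[>] 0) := by
    refine tendsto_nhdsWithin_iff.2 ⟨?_, Eventually.of_forall fun k => ?_⟩
    · simpa using (tendsto_pow_atTop_nhds_zero_of_lt_one (r := (1 / 2 : ℝ)) (by norm_num)
        (by norm_num)).const_mul (1 / 2 : ℝ)
    · exact mem_Ioi.2 (by positivity)
  -- Centres of the dyadic intervals around x. The density theorem used allows balls that contain x
  -- without being centred there.
  set w : ℕ → ℝ := fun k => (⌊x * 2 ^ k⌋₊ : ℝ) / 2 ^ k + 1 / 2 * (1 / 2) ^ k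
  have hball : ∀ k, Metric.closedBall (w k) (1 / 2 * (1 / 2) ^ k) =
      Icc ((⌊x * 2 ^ k⌋₊ : ℝ) / 2 ^ k) ((⌊x * 2 ^ k⌋₊ : ℝ) / 2 ^ k + 1 / 2 ^ k) := by
    intro k
    rw [Real.closedBall_eq_Icc, one_div_pow]
    congr 1 <;> simp only [w, one_div_pow] <;> ring
  have hmem : ∀ k, x ∈ Metric.closedBall (w k) (1 * (1 / 2 * (1 / 2) ^ k)) := by
    intro k
    have h2 : (0 : ℝ) < 2 ^ k := by positivity
    rw [one_mul, hball, ← add_div, mem_Icc, div_le_iff₀ h2, le_div_iff₀ h2]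
    exact ⟨Nat.floor_le (by positivity), (Nat.lt_floor_add_one _).le⟩
  have h34 : ENNReal.ofReal (3 / 4) < 1 := by
    rw [ENNReal.ofReal_lt_one]
    norm_num
  obtain ⟨k₀, hk₀⟩ := eventually_atTop.1
    ((hx hxS w _ hδ (Eventually.of_forall hmem)).eventually (lt_mem_nhds h34))
  refine ⟨k₀, fun k hk => ?_⟩
  have h := hk₀ k hk
  rw [hball, Real.volume_Icc, add_sub_cancel_left] at h
  have h3 := ENNReal.mul_lt_of_lt_div h
  set I := Icc ((⌊x * 2 ^ k⌋₊ : ℝ) / 2 ^ k) ((⌊x * 2 ^ k⌋₊ : ℝ) / 2 ^ k + 1 / 2 ^ k)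
  rw [← ENNReal.ofReal_mul (by norm_num)] at h3
  have hsum : volume (S ∩ I) + volume (I \ S) = ENNReal.ofReal (1 / 2 ^ k) := by
    rw [inter_comm, measure_inter_add_sdiff _ hSm, Real.volume_Icc, add_sub_cancel_left]
  refine (measure_mono (sdiff_subset_sdiff_left Ico_subset_Icc_self)).trans_lt ?_
  by_contra! hge
  have := ENNReal.add_lt_add_of_lt_of_le ENNReal.ofReal_ne_top h3 hge
  rw [hsum, ← ENNReal.ofReal_add (by positivity) (by positivity)] at this
  refine this.ne (congrArg _ ?_)
  ring

theorem leb_lev_steep {k i : ℕ} (hi : i < steepHeight k) :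
    steepLeb (lev steepCuts steepSpacers k i) = ENNReal.ofReal (1 / 2 ^ k) := by
  rw [leb_lev (by rwa [height_steep]), width_steep]

/-- The set `A` fills more than three quarters of the `i`-th level of the `k`-th column. -/
def Fills (A : Set SteepSpace) (k i : ℕ) : Prop :=
  i < steepHeight k ∧
    steepLeb (lev steepCuts steepSpacers k i \ A) < ENNReal.ofReal (1 / 4 * (1 / 2 ^ k))

/-- A set of positive measure eventually fills the levels that contain one of its points. -/
theorem exists_eventually_fills {A : Set SteepSpace} (hA : MeasurableSet A)
    (h0 : 0 < steepLeb A) :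
    ∃ x : ℝ, ∃ k₀, ∀ k ≥ k₀, Fills A k (levelIdx k ⌊x * 2 ^ k⌋₊) := by
  have emb := MeasurableEmbedding.subtype_coe (measurableSet_space steepCuts steepSpacers)
  rw [leb_apply] at h0
  obtain ⟨_, ⟨x, -, rfl⟩, h⟩ :=
    exists_eventually_dyadic_diff_lt (emb.measurableSet_image.2 hA) h0
  obtain ⟨k₀, h⟩ := h (nonneg_steep x)
  refine ⟨x, max k₀ ⌊(x : ℝ)⌋₊, fun k hk => ?_⟩
  have hi := levelIdx_lt (floor_lt_steepHeight (nonneg_steep x) ((lt_two_pow_floor x).trans_le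
    (pow_le_pow_right₀ one_le_two ((le_max_right _ _).trans hk))))
  refine ⟨hi, ?_⟩
  refine lt_of_le_of_lt ?_ (h k ((le_max_left _ _).trans hk))
  rw [leb_apply]
  refine measure_mono ?_
  rintro _ ⟨y, ⟨hy1, hy2⟩, rfl⟩
  refine ⟨?_, ?_⟩
  · have : (y : ℝ) ∈ level steepCuts steepSpacers k (levelIdx k ⌊(x : ℝ) * 2 ^ k⌋₊) := hy1
    rwa [level, leftEnd_steep hi, levelPos_levelIdx, width_steep] at this
  · rintro ⟨z, hz, hzy⟩
    exact hy2 (Subtype.ext hzy ▸ hz)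

theorem lt_leb_lev_inter {A : Set SteepSpace} {k i : ℕ} {c : ℝ} (hA : MeasurableSet A)
    (hi : i < steepHeight k) (hc : 0 ≤ c) (hck : 2 * c ≤ 1 / 2 ^ k)
    (h : steepLeb (lev steepCuts steepSpacers k i \ A) < ENNReal.ofReal c) :
    ENNReal.ofReal c < steepLeb (lev steepCuts steepSpacers k i ∩ A) := by
  by_contra! hle
  have h1 := ENNReal.add_lt_add_of_le_of_lt (ne_top_of_le_ne_top ENNReal.ofReal_ne_top hle) hle h
  rw [measure_inter_add_sdiff _ hA, leb_lev_steep hi, ← ENNReal.ofReal_add hc hc] at h1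
  exact h1.not_ge (ENNReal.ofReal_le_ofReal (by linarith))

variable {T : SteepSpace ≃ᵐ SteepSpace}

theorem Fills.frequently {A B : Set SteepSpace} (hA : MeasurableSet A) (hB : MeasurableSet B)
    {k i j : ℕ} (hfA : Fills A k i) (hfB : Fills B k j) (hij : i ≤ j)
    (hR : IsRankOne steepCuts steepSpacers T) (hT : MeasurePreserving T steepLeb steepLeb) :
    ∃ᵐ x ∂steepLeb, x ∈ A ∧ T^[j - i] x ∈ B := by
  have e : i + (j - i) = j := Nat.add_sub_cancel' hij
  refine hR.frequently hT (k := k) (i := i) (by rw [e, height_steep]; exact hfB.1) hB ?_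
  rw [e]
  have hw : (0 : ℝ) < 1 / 2 ^ k := by positivity
  exact hfB.2.trans (lt_leb_lev_inter hA hfA.1 (by positivity) (by linarith) hfA.2)

/-- The left and right halves of a level are levels of the next column at distance
`steepHeight k`. -/
theorem Fills.frequently_steepHeight {A : Set SteepSpace} (hA : MeasurableSet A)
    {k i : ℕ} (hf : Fills A k i)
    (hR : IsRankOne steepCuts steepSpacers T) (hT : MeasurePreserving T steepLeb steepLeb) :
    ∃ᵐ x ∂steepLeb, x ∈ A ∧ T^[steepHeight k] x ∈ A := by
  obtain ⟨hi, hf⟩ := hf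
  have hH := steepHeight_succ k
  have hsub : ∀ j, j = i ∨ j = i + steepHeight k →
      lev steepCuts steepSpacers (k + 1) j ⊆ lev steepCuts steepSpacers k i := by
    intro j hj x hx
    have hj' : j < steepHeight (k + 1) := by omega
    obtain ⟨h0, h1⟩ := (mem_level_steep hj').1 hx
    refine (mem_level_steep hi).2 ⟨h0, ?_⟩
    rw [← floor_mul_two_pow_succ, h1, levelPos]
    rcases hj with rfl | rfl
    · rw [if_pos hi]
      omega
    · rw [if_neg (by omega), if_pos (by omega), Nat.add_sub_cancel]
      omega
  have hlt : ∀ j, j = i ∨ j = i + steepHeight k →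
      steepLeb (lev steepCuts steepSpacers (k + 1) j \ A) < ENNReal.ofReal (1 / 4 * (1 / 2 ^ k)) :=
    fun j hj => (measure_mono (sdiff_subset_sdiff_left (hsub j hj))).trans_lt hf
  refine hR.frequently hT (k := k + 1) (i := i) (by rw [height_steep]; omega) hA ?_
  -- A quarter of the whole level is half of either half, so A misses less than half of each.
  refine (hlt _ (Or.inr rfl)).trans (lt_leb_lev_inter hA (by omega) (by positivity) ?_
    (hlt _ (Or.inl rfl)))
  rw [pow_succ]
  refine le_of_eq ?_
  field_simp
  norm_num

/-- If an invariant set and its complement both had positive measure, they would fill most of two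
levels of one column, and the power of T carrying the lower level to the upper would move points
from one set to the other. -/
theorem ergodic_steep (hR : IsRankOne steepCuts steepSpacers T)
    (hT : MeasurePreserving T steepLeb steepLeb) : Ergodic T steepLeb := by
  refine ⟨hT, ⟨fun s hs hinv => ?_⟩⟩
  have hiter : ∀ n x, T^[n] x ∈ s ↔ x ∈ s := by
    intro n x
    have hn := (Function.IsFixedPt.preimage_iterate (f := T) (s := s) hinv n : T^[n] ⁻¹' s = s)
    rw [← mem_preimage, hn]
  have hpos : ∀ A : Set SteepSpace, ¬ (∀ᵐ x ∂steepLeb, x ∉ A) → 0 < steepLeb A := fun A h =>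
    pos_iff_ne_zero.2 fun h' => h (measure_eq_zero_iff_ae_notMem.1 h')
  rw [eventuallyConst_set]
  by_contra! hcon
  obtain ⟨x, k, hk⟩ := exists_eventually_fills hs.compl
    (hpos _ fun h => hcon.1 (h.mono fun _ hx => hx))
  obtain ⟨y, l, hl⟩ := exists_eventually_fills hs (hpos _ hcon.2)
  have h1 := hk _ (le_max_left k l)
  have h2 := hl _ (le_max_right k l)
  rcases le_total (levelIdx (max k l) ⌊x * 2 ^ max k l⌋₊)
    (levelIdx (max k l) ⌊y * 2 ^ max k l⌋₊) with h | h
  · obtain ⟨z, hz1, hz2⟩ := (Fills.frequently hs.compl hs h1 h2 h hR hT).exists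
    exact hz1 ((hiter _ _).1 hz2)
  · obtain ⟨z, hz1, hz2⟩ := (Fills.frequently hs hs.compl h2 h1 h hR hT).exists
    exact hz2 ((hiter _ _).2 hz1)

/-! ### Isometric coefficients -/

theorem isometry_iterate {Y : Type*} [PseudoEMetricSpace Y] {f : Y → Y} (hf : Isometry f) (n : ℕ) :
    Isometry f^[n] := by
  induction n with
  | zero => exact isometry_id
  | succ n ih => exact ih.comp hf

theorem dist_iterate_le_mul {Y : Type*} [PseudoMetricSpace Y] {f : Y → Y} (hf : Isometry f) (y : Y)
    (n : ℕ) : dist (f^[n] y) y ≤ n * dist (f y) y := by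
  induction n with
  | zero => simp
  | succ n ih =>
    have h1 := dist_triangle (f^[n + 1] y) (f y) y
    rw [Function.iterate_succ_apply', hf.dist_eq] at h1
    rw [Function.iterate_succ_apply']
    push_cast
    linarith

theorem ae_apply_iterate_eq {X Y : Type*} [MeasurableSpace X] {μ : Measure X} {f : X → X}
    {S : Y → Y} {φ : X → Y} (hf : MeasurePreserving f μ μ) (h : ∀ᵐ x ∂μ, S (φ x) = φ (f x))
    (n : ℕ) : ∀ᵐ x ∂μ, φ (f^[n] x) = S^[n] (φ x) := by
  induction n with
  | zero => simp
  | succ n ih =>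
    filter_upwards [ih, (hf.iterate n).quasiMeasurePreserving.ae h] with x h1 h2
    rw [Function.iterate_succ_apply', Function.iterate_succ_apply', ← h2, h1]

/-- An equivariant isometry moves the essential values of a factor map by arbitrarily little. -/
theorem dist_lt_of_pos_measure_preimage_ball {Y : Type*} [MetricSpace Y] [MeasurableSpace Y]
    [BorelSpace Y] {S : Y → Y} (hS : Isometry S) {φ : SteepSpace → Y} (hφ : Measurable φ)
    (hR : IsRankOne steepCuts steepSpacers T) (hT : MeasurePreserving T steepLeb steepLeb)
    (h : ∀ᵐ x ∂steepLeb, S (φ x) = φ (T x)) {y : Y} {ε : ℝ}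
    (hpos : 0 < steepLeb (φ ⁻¹' Metric.ball y ε)) : dist (S y) y < 10 * ε := by
  have hm : MeasurableSet (φ ⁻¹' Metric.ball y ε) := hφ Metric.isOpen_ball.measurableSet
  obtain ⟨x, k, hk⟩ := exists_eventually_fills hm hpos
  have key : ∀ l ≥ k, dist (S^[steepHeight l] y) y < 2 * ε := by
    intro l hl
    obtain ⟨z, ⟨hz1, hz2⟩, hz⟩ := (((hk l hl).frequently_steepHeight hm hR hT).and_eventually
      (ae_apply_iterate_eq hT h (steepHeight l))).exists
    rw [mem_preimage, Metric.mem_ball] at hz1 hz2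
    rw [hz] at hz2
    have h1 := dist_triangle_left (S^[steepHeight l] y) y (S^[steepHeight l] (φ z))
    rw [(isometry_iterate hS _).dist_eq] at h1
    linarith
  have h1 := key k le_rfl
  have h2 := key (k + 1) (Nat.le_succ k)
  -- Four moves by S^(h_k) cost less than 8ε; after one more application of S this compares
  -- S^(h_(k+1)) y with S y, and the return at stage k + 1 adds 2ε.
  have h4 := dist_iterate_le_mul (isometry_iterate hS (steepHeight k)) y 4
  rw [← Function.iterate_mul, mul_comm, ← hS.dist_eq, ← Function.iterate_succ_apply' S,
    Nat.succ_eq_add_one, ← steepHeight_succ] at h4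
  have h5 := dist_triangle_left (S y) y (S^[steepHeight (k + 1)] y)
  push_cast at h4
  linarith

theorem ergodicIsometricCoefficients_steep (hR : IsRankOne steepCuts steepSpacers T)
    (hT : MeasurePreserving T steepLeb steepLeb) :
    ErgodicIsometricCoefficients.{0, v} steepLeb T := by
  intro Y _ _ _ _ S φ hφ h
  have hE := ergodic_steep hR hT
  have : SecondCountableTopology Y := UniformSpace.secondCountable_of_separable Y
  have hne : Nonempty SteepSpace := ⟨⟨0, space_steep.superset (mem_Ici.2 le_rfl)⟩⟩
  have : Nonempty Y := hne.map φ
  have hgm : Measurable fun x => dist (S (φ x)) (φ x) :=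
    (S.continuous.measurable.comp hφ).dist hφ
  obtain ⟨c, hc⟩ := hE.ae_eq_const_of_ae_eq_comp₀ hgm.nullMeasurable (by
    filter_upwards [h] with x hx
    rw [Function.comp_apply, ← hx, S.dist_eq])
  -- The 12ε is 10ε for the displacement of the centre of a ball, plus ε twice for passing from the
  -- centre to φ x. Separability provides a ball whose preimage has positive measure.
  have hc0 : ∀ ε > 0, c < 12 * ε := by
    intro ε hε
    obtain ⟨n, hn⟩ : ∃ n, 0 < steepLeb (φ ⁻¹' Metric.ball (TopologicalSpace.denseSeq Y n) ε) := by
      by_contra! hcon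
      have hU : ⋃ n, φ ⁻¹' Metric.ball (TopologicalSpace.denseSeq Y n) ε = univ := by
        refine eq_univ_of_forall fun x => ?_
        obtain ⟨n, hn⟩ := (TopologicalSpace.denseRange_denseSeq Y).exists_dist_lt (φ x) hε
        exact mem_iUnion.2 ⟨n, hn⟩
      have h0 := measure_iUnion_null (μ := steepLeb) fun n => nonpos_iff_eq_zero.1 (hcon n)
      rw [hU, leb_univ_steep] at h0
      exact ENNReal.top_ne_zero h0
    have hd := dist_lt_of_pos_measure_preimage_ball S.isometry hφ hR hT h hn
    have hf : ∃ᵐ x ∂steepLeb, x ∈ φ ⁻¹' Metric.ball (TopologicalSpace.denseSeq Y n) ε := by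
      rw [frequently_ae_iff]
      exact hn.ne'
    obtain ⟨x, hx1, hx2⟩ := (hf.and_eventually hc).exists
    rw [mem_preimage, Metric.mem_ball] at hx1
    have e : dist (S (φ x)) (φ x) = c := hx2
    have t1 := dist_triangle4_right (S (φ x)) (φ x) (S (TopologicalSpace.denseSeq Y n))
      (TopologicalSpace.denseSeq Y n)
    rw [S.dist_eq] at t1
    linarith
  have hcn : c ≤ 0 := le_of_forall_pos_lt_add fun ε hε => by
    have := hc0 (ε / 12) (by positivity)
    linarith
  obtain ⟨y, hy⟩ := hE.ae_eq_const_of_ae_eq_comp₀ hφ.nullMeasurable (by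
    filter_upwards [h, hc] with x h1 h2
    have e : dist (S (φ x)) (φ x) = c := h2
    rw [Function.comp_apply, ← h1]
    exact dist_le_zero.1 (e.trans_le hcn))
  exact ⟨y, hy⟩

/-! ### Failure of weak double ergodicity -/

/-- `IsDesc k i` says that the bottom level of the first column contains the `i`-th level of
column `k + 1`. -/
def IsDesc : ℕ → ℕ → Prop
  | 0, i => i = 0
  | k + 1, i => IsDesc k i ∨ ∃ j, IsDesc k j ∧ i = j + steepHeight (k + 1)

/-- The largest such index is h_1 + ... + h_k, and h_(k+1) = 4h_k + 1 keeps three times this sum at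
least 5 below h_(k+1). -/
theorem IsDesc.le {k i : ℕ} (h : IsDesc k i) : 3 * i + 5 ≤ steepHeight (k + 1) := by
  induction k generalizing i with
  | zero =>
    rw [IsDesc] at h
    simp [h, steepHeight]
  | succ k ih =>
    rw [steepHeight_succ]
    rcases h with h | ⟨j, h, rfl⟩
    · have := ih h; omega
    · have := ih h; omega

/-- If h_(k+1) occurs equally often on both sides, induction applies. Otherwise one extra copy of it
outweighs the lower terms: by `IsDesc.le` these change the difference by at most 2(h_(k+1) - 5)/3,
which leaves at least 5. -/
theorem IsDesc.add_eq_or {k a b c d : ℕ} (ha : IsDesc k a) (hb : IsDesc k b) (hc : IsDesc k c)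
    (hd : IsDesc k d) : a + b = c + d ∨ a + b + 5 ≤ c + d ∨ c + d + 5 ≤ a + b := by
  induction k generalizing a b c d with
  | zero =>
    rw [IsDesc] at ha hb hc hd
    omega
  | succ k ih =>
    rcases ha with ha | ⟨a', ha, rfl⟩ <;> rcases hb with hb | ⟨b', hb, rfl⟩ <;>
    rcases hc with hc | ⟨c', hc, rfl⟩ <;> rcases hd with hd | ⟨d', hd, rfl⟩ <;>
    have h := ih ha hb hc hd <;> have ha' := ha.le <;> have hb' := hb.le <;>
    have hc' := hc.le <;> have hd' := hd.le <;> omega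

/-- Passing to the next column keeps the index for the left half and adds the height for the right
half, so the offset j above the copy of the base level persists. -/
theorem exists_isDesc_levelIdx {x : ℝ} {j : ℕ} (hj : j ≤ 1)
    (hx : levelIdx 1 ⌊x * 2 ^ 1⌋₊ = j) (k : ℕ) :
    ∃ q, IsDesc k q ∧ levelIdx (k + 1) ⌊x * 2 ^ (k + 1)⌋₊ = q + j := by
  induction k with
  | zero => exact ⟨0, rfl, by simpa using hx⟩
  | succ k ih =>
    obtain ⟨q, hq, h⟩ := ih
    have hle := hq.le
    have hm := floor_mul_two_pow_succ x (k + 1)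
    have hlt := @levelPos_lt (k + 1) (q + j) (by omega)
    rw [← h, levelPos_levelIdx] at hlt
    rw [levelIdx, if_pos (by omega), hm, h]
    split_ifs
    · exact ⟨q, Or.inl hq, rfl⟩
    · exact ⟨q + steepHeight (k + 1), Or.inr ⟨q, hq, rfl⟩, by omega⟩

theorem ae_exists_isDesc (hR : IsRankOne steepCuts steepSpacers T)
    (hT : MeasurePreserving T steepLeb steepLeb) {i j : ℕ} (hi : i ≤ 1) (hj : j ≤ 1) (n : ℕ) :
    ∀ᵐ x ∂steepLeb, x ∈ lev steepCuts steepSpacers 1 i →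
      T^[n] x ∈ lev steepCuts steepSpacers 1 j →
      ∃ p q, IsDesc n p ∧ IsDesc n q ∧ p + i + n = q + j := by
  -- Column n + 1 is tall enough: a copy of the base level has index below a third of its height and
  -- n is below a quarter, so n steps up from there stay inside the column.
  have hn := four_pow_le_steepHeight (n + 1)
  have hn' := Nat.lt_pow_self (n := n) (a := 4) (by norm_num)
  rw [pow_succ] at hn
  have h1 : steepHeight 1 = 5 := rfl
  have hall : ∀ l < steepHeight (n + 1), l + n < steepHeight (n + 1) → ∀ᵐ (x : SteepSpace) ∂steepLeb,
      (x : ℝ) ∈ level steepCuts steepSpacers (n + 1) l →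
      ((T^[n] x : SteepSpace) : ℝ) ∈ level steepCuts steepSpacers (n + 1) (l + n) :=
    fun l _ hl => hR.iterate hT n (by rwa [height_steep])
  have hall' := ae_all_iff.2 fun l => ae_all_iff.2 fun h => ae_all_iff.2 fun h' => hall l h h'
  filter_upwards [hall'] with x hx hxi hxj
  have hxi' := ((mem_level_steep (by omega)).1 hxi).2
  have hxj' := ((mem_level_steep (by omega)).1 hxj).2
  obtain ⟨p, hp, hpe⟩ := exists_isDesc_levelIdx hi (by rw [hxi', levelIdx_levelPos]) n
  obtain ⟨q, hq, hqe⟩ := exists_isDesc_levelIdx hj (by rw [hxj', levelIdx_levelPos]) n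
  have hple := hp.le
  have hTx := hx (p + i) (by omega) (by omega)
    ((mem_level_steep (by omega)).2 ⟨nonneg_steep x, by rw [← hpe, levelPos_levelIdx]⟩)
  have e := ((mem_level_steep (by omega)).1 hTx).2
  rw [e, levelIdx_levelPos] at hqe
  exact ⟨p, q, hp, hq, hqe⟩

theorem measure_zpow_image_inter {X : Type*} [MeasurableSpace X] {μ : Measure X} {T : X ≃ᵐ X}
    (hT : MeasurePreserving T μ μ) {A B : Set X} (hA : MeasurableSet A) (hB : MeasurableSet B)
    (n : ℕ) :
    μ ((((T.toEquiv : Equiv.Perm X) ^ (n : ℤ)) '' A) ∩ B) = μ (A ∩ T^[n] ⁻¹' B) ∧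
    μ ((((T.toEquiv : Equiv.Perm X) ^ (-(n : ℤ))) '' A) ∩ B) = μ (B ∩ T^[n] ⁻¹' A) := by
  have hpow : ∀ x, ((T.toEquiv : Equiv.Perm X) ^ n) x = T^[n] x := by
    intro x
    rw [Equiv.Perm.iterate_eq_pow T.toEquiv n |>.symm]
    rfl
  have hpow' : ⇑((T.toEquiv : Equiv.Perm X) ^ n) = T^[n] := funext hpow
  have hemb : MeasurableEmbedding T^[n] := by
    clear hpow hpow'
    induction n with
    | zero => exact MeasurableEmbedding.id
    | succ n ih => exact ih.comp T.measurableEmbedding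
  have hB' : MeasurableSet (A ∩ T^[n] ⁻¹' B) := hA.inter ((T.measurable.iterate n) hB)
  constructor
  · rw [zpow_natCast, hpow', ← image_inter_preimage]
    rw [← (hT.iterate n).measure_preimage (hemb.measurableSet_image.2 hB').nullMeasurableSet,
      preimage_image_eq _ hemb.injective]
  · rw [zpow_neg, zpow_natCast, Equiv.Perm.inv_def, Equiv.image_symm_eq_preimage, hpow', inter_comm]

theorem not_weaklyDoublyErgodic_steep (hR : IsRankOne steepCuts steepSpacers T)
    (hT : MeasurePreserving T steepLeb steepLeb) : ¬ WeaklyDoublyErgodic steepLeb T := by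
  intro hW
  have hpos : ∀ i ≤ 1, 0 < steepLeb (lev steepCuts steepSpacers 1 i) := by
    intro i hi
    rw [leb_lev_steep (hi.trans_lt (by decide)), ENNReal.ofReal_pos]
    positivity
  have hex : ∀ {A B : Set SteepSpace}, 0 < steepLeb (A ∩ B) → ∃ᵐ x ∂steepLeb, x ∈ A ∧ x ∈ B := by
    intro A B h
    rw [frequently_ae_iff]
    exact h.ne'
  obtain ⟨n, h1, h2⟩ := hW _ _ (measurableSet_lev 1 0) (measurableSet_lev 1 1) (hpos 0 zero_le_one)
    (hpos 1 le_rfl)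
  have m0 := measurableSet_lev (r := steepCuts) (s := steepSpacers) 1 0
  have m1 := measurableSet_lev (r := steepCuts) (s := steepSpacers) 1 1
  obtain ⟨n, rfl | rfl⟩ := n.eq_nat_or_neg
  · rw [(measure_zpow_image_inter hT m0 m0 n).1] at h1
    rw [(measure_zpow_image_inter hT m0 m1 n).1] at h2
    obtain ⟨x, ⟨hx1, hx2⟩, hx⟩ := ((hex h1).and_eventually
      (ae_exists_isDesc hR hT zero_le_one zero_le_one n)).exists
    obtain ⟨y, ⟨hy1, hy2⟩, hy⟩ := ((hex h2).and_eventually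
      (ae_exists_isDesc hR hT zero_le_one le_rfl n)).exists
    obtain ⟨a, b, ha, hb, hab⟩ := hx hx1 hx2
    obtain ⟨c, d, hc, hd, hcd⟩ := hy hy1 hy2
    -- The returns give b - a = n = d + 1 - c, so a + d and b + c differ by 1. For negative powers
    -- the offset 1 is on the other side.
    have := ha.add_eq_or hd hb hc
    omega
  · rw [(measure_zpow_image_inter hT m0 m0 n).2] at h1
    rw [(measure_zpow_image_inter hT m0 m1 n).2] at h2
    obtain ⟨x, ⟨hx1, hx2⟩, hx⟩ := ((hex h1).and_eventually
      (ae_exists_isDesc hR hT zero_le_one zero_le_one n)).exists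
    obtain ⟨y, ⟨hy1, hy2⟩, hy⟩ := ((hex h2).and_eventually
      (ae_exists_isDesc hR hT le_rfl zero_le_one n)).exists
    obtain ⟨a, b, ha, hb, hab⟩ := hx hx1 hx2
    obtain ⟨c, d, hc, hd, hcd⟩ := hy hy1 hy2
    have := ha.add_eq_or hd hb hc
    omega

end CutStack

theorem mainTheorem1 :
    ∃ (r : ℕ → ℕ) (s : ℕ → ℕ → ℕ) (T : CutStack.space r s ≃ᵐ CutStack.space r s),
      (∀ k, r k = 2) ∧
      (∀ k, s k 0 = 0 ∧ s k 1 = 2 * CutStack.height r s k + 1) ∧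
      CutStack.height r s 0 = 1 ∧
      (∀ k, CutStack.height r s (k + 1) = 4 * CutStack.height r s k + 1) ∧
      CutStack.IsRankOne r s T ∧
      SigmaFinite (CutStack.leb r s) ∧
      CutStack.leb r s Set.univ = ⊤ ∧
      MeasurePreserving T (CutStack.leb r s) (CutStack.leb r s) ∧
      ErgodicIsometricCoefficients.{0, v} (CutStack.leb r s) T ∧
      ¬ WeaklyDoublyErgodic (CutStack.leb r s) T := by
  obtain ⟨T, hR, hT⟩ := CutStack.exists_isRankOne_steep
  refine ⟨CutStack.steepCuts, CutStack.steepSpacers, T, fun _ => rfl, fun k => ⟨rfl, ?_⟩, rfl,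
    fun k => ?_, hR, inferInstance, CutStack.leb_univ_steep, hT,
    CutStack.ergodicIsometricCoefficients_steep hR hT, CutStack.not_weaklyDoublyErgodic_steep hR hT⟩
  · rw [CutStack.height_steep]
    rfl
  · rw [CutStack.height_steep, CutStack.height_steep, CutStack.steepHeight_succ]
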